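/- A permutation of length $n$ is an ordered list $\sigma=\sigma(1)\sigma(2)\cdots\sigma(n)$ of the elements of $\{1,2,\dots,n\}$ in which each element appears exactly once. Let $\mathsf{Pop}(\sigma)$ be the permutation obtained from $\sigma$ by reversing, in place, every maximal decreasing run of consecutive entries of $\sigma$; for example, $\mathsf{Pop}(471836952)=417386259$. For every permutation $\sigma$ of length $n$ there is an integer $t\ge 0$ such that the iterate $\mathsf{Pop}^t(\sigma)$ is the increasing permutation $12\cdots n$; let $T(\sigma)$ be the least such $t$, and let $$\mathcal{D}_n^{\mathsf{Pop}}=\frac{1}{n!}\sum_{\sigma}T(\sigma)$$ be the average of $T(\sigma)$ over all $n!$ permutations $\sigma$ of length $n$. **Theorem 1.1.** $$\liminf_{n\to\infty}\frac{\mathcal{D}_n^{\mathsf{Pop}}}{n}\ \ge\ \frac35 .$$ -/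

import Mathlib

/-- The map `Pop`: cut a list into its maximal (strictly) decreasing runs of consecutive entries,
and reverse each of these runs in place. -/
def pop (l : List ℕ) : List ℕ :=
  ((l.splitBy (fun a b => decide (b < a))).map List.reverse).flatten

/-- The one-line notation of a permutation of length `n`, as a list of the numbers `1, …, n`
(`Fin n` has the elements `0, …, n - 1`, so that all values are shifted by one). -/
def oneLine {n : ℕ} (σ : Equiv.Perm (Fin n)) : List ℕ :=
  List.ofFn (fun i => (σ i : ℕ) + 1)

theorem pop_perm (l : List ℕ) : (pop l).Perm l := by
  have h : ∀ L : List (List ℕ), ((L.map List.reverse).flatten).Perm L.flatten := by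
    intro L
    induction L with
    | nil => simp
    | cons b L ih => simpa using (List.reverse_perm b).append ih
  simpa [pop] using h (l.splitBy (fun a b => decide (b < a)))

theorem flatten_map_reverse_lt_or (L : List (List ℕ))
    (hL : ∀ b ∈ L, b.IsChain (fun x y => y < x)) (hne : ∀ b ∈ L, b ≠ []) :
    (L.map List.reverse).flatten < L.flatten ∨ ∃ l : List ℕ, L = l.map (fun x => [x]) := by
  induction L with
  | nil => exact Or.inr ⟨[], rfl⟩
  | cons b L ih =>
    have ih' := ih (fun c hc => hL c (by simp [hc])) (fun c hc => hne c (by simp [hc]))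
    have hb := hL b (by simp)
    match b, hb, hne b (by simp) with
    | [x], _, _ =>
      rcases ih' with h | ⟨l, rfl⟩
      · exact Or.inl (by simpa using h)
      · exact Or.inr ⟨x :: l, by simp⟩
    | x :: y :: t, hb, _ =>
      left
      have hp : List.Pairwise (fun x y : ℕ => y < x) (x :: y :: t) :=
        haveI : IsTrans ℕ (fun x y : ℕ => y < x) := ⟨fun _ _ _ h1 h2 => lt_trans h2 h1⟩
        List.isChain_iff_pairwise.1 hb
      have hmem : ∀ z ∈ y :: t, z < x := (List.pairwise_cons.1 hp).1
      obtain ⟨z, s, hs⟩ : ∃ z s, (y :: t).reverse = z :: s :=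
        List.exists_cons_of_ne_nil (by simp)
      have hz : z < x := hmem z (by rw [← List.mem_reverse, hs]; simp)
      have : (x :: y :: t).reverse = z :: (s ++ [x]) := by
        rw [List.reverse_cons, hs]; rfl
      simp only [List.map_cons, List.flatten_cons, this, List.cons_append]
      exact List.cons_lt_cons_iff.2 (Or.inl hz)

theorem pop_lt_or_sorted (l : List ℕ) : pop l < l ∨ l.Pairwise (· ≤ ·) := by
  have key := flatten_map_reverse_lt_or (l.splitBy (fun a b => decide (b < a)))
    (fun b hb => by simpa using List.isChain_of_mem_splitBy hb)
    (fun b hb => List.ne_nil_of_mem_splitBy hb)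
  rcases key with h | ⟨m, hm⟩
  · left
    simpa [pop] using h
  · right
    have hl : l = m := by
      have := List.flatten_splitBy (fun a b : ℕ => decide (b < a)) l
      rw [hm, ← List.flatMap_def, List.flatMap_singleton'] at this
      exact this.symm
    have hc := List.isChain_getLast_head_splitBy (fun a b : ℕ => decide (b < a)) l
    rw [hm, List.isChain_map] at hc
    rw [hl, ← List.isChain_iff_pairwise]
    refine List.IsChain.imp (fun a b hab => ?_) hc
    obtain ⟨_, _, h⟩ := hab
    exact not_lt.1 (of_decide_eq_false h)

theorem exists_pop_iterate_sorted (l : List ℕ) : ∃ t, (pop^[t] l).Pairwise (· ≤ ·) := by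
  by_contra! h
  have hperm : ∀ t, (pop^[t] l).Perm l := by
    intro t
    induction t with
    | zero => simp
    | succ t ih => rw [Function.iterate_succ_apply']; exact (pop_perm _).trans ih
  have hanti : StrictAnti (fun t => pop^[t] l) := by
    refine strictAnti_nat_of_succ_lt fun t => ?_
    rw [Function.iterate_succ_apply']
    exact (pop_lt_or_sorted _).resolve_right (h t)
  have hfin : (Set.range (fun t => pop^[t] l)).Finite := by
    refine (List.finite_toSet l.permutations).subset ?_
    rintro _ ⟨t, rfl⟩
    exact List.mem_permutations.2 (hperm t)
  exact Set.infinite_range_of_injective hanti.injective hfin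

theorem exists_pop_iterate_eq_range {n : ℕ} (σ : Equiv.Perm (Fin n)) :
    ∃ t, pop^[t] (oneLine σ) = List.range' 1 n := by
  obtain ⟨t, ht⟩ := exists_pop_iterate_sorted (oneLine σ)
  have hperm : ∀ t, (pop^[t] (oneLine σ)).Perm (oneLine σ) := by
    intro t
    induction t with
    | zero => simp
    | succ t ih => rw [Function.iterate_succ_apply']; exact (pop_perm _).trans ih
  have h1 : (oneLine σ).Perm (List.range' 1 n) := by
    have h2 : (oneLine σ).Perm (List.ofFn (fun i : Fin n => (i : ℕ) + 1)) :=
      Equiv.Perm.ofFn_comp_perm σ (fun i : Fin n => (i : ℕ) + 1)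
    have h3 : List.ofFn (fun i : Fin n => (i : ℕ) + 1) = List.range' 1 n := by
      apply List.ext_getElem <;> simp [add_comm]
    rwa [h3] at h2
  refine ⟨t, ((hperm t).trans h1).eq_of_pairwise (fun a b _ _ => le_antisymm) ht ?_⟩
  exact (List.pairwise_lt_range' (s := 1) (n := n)).imp le_of_lt

/-- The number of iterations of `Pop` needed to sort `σ`: the least `t` for which the `t`-th iterate
of `Pop` at `σ` is the increasing permutation `1 2 … n`. -/
def popTime {n : ℕ} (σ : Equiv.Perm (Fin n)) : ℕ :=
  Nat.find (exists_pop_iterate_eq_range σ)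

/-- The average of `popTime` over all permutations of length `n`. -/
noncomputable def avgPopTime (n : ℕ) : ℝ :=
  (∑ σ : Equiv.Perm (Fin n), (popTime σ : ℝ)) / (Fintype.card (Equiv.Perm (Fin n)) : ℝ)

/-! After one application of `pop`, a list has no four consecutive descending entries, so every
later step moves a small entry left by at most 2. A move by 2 needs a triple descent `x > y > z`,
and at time `t` such a triple has at least `t / 2` entries before it (`time_le_of_triple_descent`).
A small entry near position `r` therefore moves at speed at most 2 until about time `2r/5`, when it
is near `r/5`, and at speed at most 1 afterwards: about `3r/5` steps in all
(`HasSmallFrom.three_mul_le`).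

For a random permutation, with high probability some value at most `m` lies in the last `m`
positions and the `m` positions before those are not entirely decreasing. The first step then leaves
a small entry at position at least `n - 2m`. Taking `m` about `n / K`, then `n → ∞` and `K → ∞`,
gives the constant. -/

/-! ### Descents in the image of `pop` -/

theorem exists_blocks (v : List ℕ) : ∃ L : List (List ℕ),
    L.flatten = v ∧ (L.map List.reverse).flatten = pop v ∧
    (∀ b ∈ L, b.Pairwise (fun x y => y < x)) ∧ (∀ b ∈ L, b ≠ []) ∧
    L.IsChain (fun a b => ∃ ha hb, a.getLast ha ≤ b.head hb) := by
  refine ⟨v.splitBy (fun a b => decide (b < a)), List.flatten_splitBy _ _, rfl, fun b hb => ?_,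
    fun b hb => List.ne_nil_of_mem_splitBy hb, ?_⟩
  · have : IsTrans ℕ (fun x y : ℕ => y < x) := ⟨fun _ _ _ h1 h2 => lt_trans h2 h1⟩
    exact List.isChain_iff_pairwise.1 (by simpa using List.isChain_of_mem_splitBy hb)
  · refine List.IsChain.imp (fun a b hab => ?_) (List.isChain_getLast_head_splitBy _ v)
    obtain ⟨ha, hb, h⟩ := hab
    exact ⟨ha, hb, not_lt.1 (of_decide_eq_false h)⟩

theorem flatten_map_reverse_perm (L : List (List ℕ)) :
    ((L.map List.reverse).flatten).Perm L.flatten := by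
  induction L with
  | nil => simp
  | cons b L ih => simpa using (List.reverse_perm b).append ih

/-- A descent of `pop v` separates two reversed decreasing runs of `v`. -/
theorem pop_eq_append_of_descent {v P Q : List ℕ} {x y : ℕ} (h : pop v = P ++ x :: y :: Q)
    (hyx : y < x) : ∃ v₁ b c v₂ P' Q' : List ℕ, v = v₁ ++ (x :: b) ++ (c ++ [y]) ++ v₂ ∧
      P = P' ++ b.reverse ∧ P'.Perm v₁ ∧ Q = c.reverse ++ Q' ∧
      (x :: b).Pairwise (fun x y => y < x) ∧ (c ++ [y]).Pairwise (fun x y => y < x) ∧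
      (x :: b).getLast (by simp) ≤ (c ++ [y]).head (by simp) := by
  obtain ⟨L, rfl, hL, hd, hne, hc⟩ := exists_blocks v
  have key : ∃ L₁ L₂, L = L₁ ++ L₂ ∧ (L₁.map List.reverse).flatten = P ++ [x] ∧
      (L₂.map List.reverse).flatten = y :: Q := by
    have h' : (L.map List.reverse).flatten = (P ++ [x]) ++ (y :: Q) := by rw [hL, h]; simp
    rcases List.flatten_eq_append_iff.1 h' with ⟨as, bs, h1, h2, h3⟩ | ⟨as, bs, c, cs, ds, h1, h2, h3⟩
    · obtain ⟨L₁, L₂, rfl, rfl, rfl⟩ := List.map_eq_append_iff.1 h1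
      exact ⟨L₁, L₂, rfl, h2.symm, h3.symm⟩
    · obtain ⟨L₁, L₂, rfl, rfl, h5⟩ := List.map_eq_append_iff.1 h1
      obtain ⟨e, L₃, rfl, h6, rfl⟩ := List.map_eq_cons_iff.1 h5
      rcases List.eq_nil_or_concat bs with rfl | ⟨bs', w, rfl⟩
      · refine ⟨L₁, e :: L₃, rfl, by simpa using h2.symm, ?_⟩
        simp only [List.map_cons, List.flatten_cons, h6, h3]; simp
      · exfalso
        have hw : x = w := by
          have := congrArg List.getLast? h2
          simpa using this
        have hy : y = c := by simpa using congrArg List.head? h3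
        have he := hd e (by simp)
        rw [← List.pairwise_reverse, h6] at he
        subst hw hy
        exact absurd ((List.pairwise_append.1 he).2.2 x (by simp) y (by simp)) (by omega)
  obtain ⟨L₁, L₂, rfl, h1, h2⟩ := key
  rcases List.eq_nil_or_concat L₁ with rfl | ⟨L₁, b, rfl⟩
  · simp at h1
  rcases L₂ with _ | ⟨c, L₂⟩
  · simp at h2
  have hb := hne b (by simp)
  have hcn := hne c (by simp)
  obtain ⟨x', b, rfl⟩ := List.exists_cons_of_ne_nil hb
  obtain ⟨c, y', rfl⟩ := (List.eq_nil_or_concat c).resolve_left hcn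
  simp only [List.concat_eq_append] at *
  have hx : x' = x := by
    have := congrArg List.getLast? h1
    simpa using this
  have hy : y' = y := by simpa using congrArg List.head? h2
  subst hx hy
  refine ⟨L₁.flatten, b, c, L₂.flatten, (L₁.map List.reverse).flatten,
    (L₂.map List.reverse).flatten, by simp, ?_, flatten_map_reverse_perm _, ?_,
    hd _ (by simp), hd _ (by simp), ?_⟩
  · exact List.append_cancel_right (bs := [x']) (by simpa using h1.symm)
  · simpa using h2.symm
  · rw [List.append_assoc] at hc
    have := (List.isChain_append_cons_cons.1 hc).2.1
    obtain ⟨_, _, h⟩ := this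
    exact h

/-- Reversed runs increase, so `p > q` and `r > w` force the runs of `q` and `r` to be singletons;
adjacent runs `[q]`, `[r]` require `q ≤ r`. -/
theorem pop_ne_of_four_descending (v A C : List ℕ) {p q r w : ℕ} (h1 : q < p) (h2 : r < q)
    (h3 : w < r) : pop v ≠ A ++ p :: q :: r :: w :: C := by
  intro h
  obtain ⟨v₁, b, c, v₂, P', Q', -, hP, -, hQ, hb, hc, hle⟩ :=
    pop_eq_append_of_descent (P := A ++ [p]) (x := q) (y := r) (by simpa using h) h2
  have hb' : b = [] := by
    rcases b with _ | ⟨s, b⟩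
    · rfl
    · have hs : p = s := by simpa using congrArg List.getLast? hP
      have := (List.pairwise_cons.1 hb).1 s (by simp)
      omega
  have hc' : c = [] := by
    rcases List.eq_nil_or_concat c with rfl | ⟨c, s, rfl⟩
    · rfl
    · have hs : w = s := by simpa using congrArg List.head? hQ
      have := (List.pairwise_append.1 hc).2.2 s (by simp) r (by simp)
      omega
  subst hb' hc'
  simp at hle
  omega

/-! ### Late descent patterns need many entries to their left -/

theorem exists_threshold_crossing (θ : ℕ) : ∀ (p : ℕ) (w : List ℕ), θ < p →
    (p :: w).Pairwise (fun x y => y < x) → (p :: w).getLast (by simp) ≤ θ →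
    ∃ w₁ x y w₂, p :: w = w₁ ++ x :: y :: w₂ ∧ (∀ a ∈ w₁, θ < a) ∧ θ < x ∧ y ≤ θ ∧
      (∀ a ∈ w₂, a < y)
  | p, [], hp, _, hl => by simp at hl; omega
  | p, q :: w, hp, hd, hl => by
    have hd' := (List.pairwise_cons.1 hd).2
    rcases le_or_gt q θ with hq | hq
    · exact ⟨[], p, q, w, rfl, by simp, hp, hq, (List.pairwise_cons.1 hd').1⟩
    · obtain ⟨w₁, x, y, w₂, h, h1, h2, h3, h4⟩ :=
        exists_threshold_crossing θ q w hq hd' (by simpa using hl)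
      refine ⟨p :: w₁, x, y, w₂, by simp [h], ?_, h2, h3, h4⟩
      simpa [hp] using h1

theorem countP_le_eq_zero {θ : ℕ} {w : List ℕ} (h : ∀ a ∈ w, θ < a) : w.countP (· ≤ θ) = 0 := by
  rw [List.countP_eq_zero]
  intro a ha
  simpa using h a ha

/-- The pattern is traced back in time: the descent `x > y` comes from two adjacent runs, one of
which crosses `θ` one step earlier. The two bounds alternate, so two steps back cost at least one
entry `≤ θ` of the prefix. -/
theorem time_le_of_descent_pattern (θ : ℕ) (l : List ℕ) : ∀ (t : ℕ) (A : List ℕ) (x y z : ℕ)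
    (C : List ℕ), pop^[t] l = A ++ x :: y :: z :: C → θ < x → y ≤ θ → z ≤ θ →
    t ≤ 2 * A.countP (· ≤ θ) + 1 ∧ (z < y → t ≤ 2 * A.countP (· ≤ θ))
  | 0, _, _, _, _, _, _, _, _, _ => by simp
  | t + 1, A, x, y, z, C, h, hx, hy, hz => by
    rw [Function.iterate_succ_apply'] at h
    obtain ⟨v₁, b, c, v₂, P', Q', hv, hP, hperm, hQ, hb, hc, hle⟩ :=
      pop_eq_append_of_descent h (hy.trans_lt hx)
    have hcount : A.countP (· ≤ θ) = v₁.countP (· ≤ θ) + (x :: b).countP (· ≤ θ) := by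
      rw [hP, List.countP_append, hperm.countP_eq, List.countP_reverse,
        List.countP_cons_of_neg (by simpa using hx)]
    -- If the second run starts at or below `θ`, the first run crosses `θ`, and its entry `q`,
    -- counted in `A`, leaves the prefix.
    rcases le_or_gt ((c ++ [y]).head (by simp)) θ with hh | hh
    · obtain ⟨w₁, p, q, w₂, hw, hw₁, hp, hq, hw₂⟩ :=
        exists_threshold_crossing θ x b hx hb (hle.trans hh)
      obtain ⟨r, w, hr, hrθ⟩ : ∃ r w, w₂ ++ (c ++ [y]) = r :: w ∧ r ≤ θ := by
        rcases w₂ with _ | ⟨r, w₂⟩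
        · obtain ⟨r, w, hr⟩ := List.exists_cons_of_ne_nil (l := c ++ [y]) (by simp)
          exact ⟨r, w, by simpa using hr, by simpa [hr] using hh⟩
        · exact ⟨r, _, List.cons_append, (hw₂ r (by simp)).le.trans hq⟩
      have hv' : pop^[t] l = (v₁ ++ w₁) ++ p :: q :: r :: (w ++ v₂) := by
        have : w₁ ++ p :: q :: w₂ ++ (c ++ [y]) = w₁ ++ p :: q :: r :: w := by simp [← hr]
        calc pop^[t] l = v₁ ++ (w₁ ++ p :: q :: w₂ ++ (c ++ [y])) ++ v₂ := by
              rw [hv, hw]; simp only [List.append_assoc]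
          _ = _ := by rw [this]; simp
      have ih := (time_le_of_descent_pattern θ l t _ _ _ _ _ hv' hp hq hrθ).1
      rw [List.countP_append, countP_le_eq_zero hw₁] at ih
      have : 0 < (x :: b).countP (· ≤ θ) :=
        List.countP_pos_iff.2 ⟨q, by rw [hw]; simp, by simpa using hq⟩
      omega
    -- Otherwise the crossing is in the second run, which ends in `z > y`. The strict bound is then
    -- vacuous now, but available one step earlier with the same count.
    · rcases List.eq_nil_or_concat c with rfl | ⟨c', z', rfl⟩
      · simp at hh; omega
      simp only [List.concat_eq_append] at *
      have hz' : z = z' := by simpa using congrArg List.head? hQ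
      subst hz'
      have hyz : y < z := (List.pairwise_append.1 hc).2.2 z (by simp) y (by simp)
      obtain ⟨p₀, w₀, hpw⟩ := List.exists_cons_of_ne_nil (l := c' ++ [z] ++ [y]) (by simp)
      have hlast : (p₀ :: w₀).getLast (by simp) = y := by simp [← hpw]
      obtain ⟨w₁, p, q, w₂, hw, hw₁, hp, hq, hw₂⟩ :=
        exists_threshold_crossing θ p₀ w₀ (by simpa [hpw] using hh) (hpw ▸ hc) (by omega)
      have hw₂n : w₂ ≠ [] := by
        rintro rfl
        have h1 : c' ++ [z, y] = w₁ ++ [p, q] := by rw [← hw, ← hpw]; simp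
        have := (List.append_inj' h1 rfl).2
        simp at this
        omega
      obtain ⟨r, w₂, rfl⟩ := List.exists_cons_of_ne_nil hw₂n
      have hrq : r < q := hw₂ r (by simp)
      have hv' : pop^[t] l = (v₁ ++ (x :: b) ++ w₁) ++ p :: q :: r :: (w₂ ++ v₂) := by
        rw [hv, hpw, hw]; simp
      have ih := (time_le_of_descent_pattern θ l t _ _ _ _ _ hv' hp hq (by omega)).2 hrq
      rw [List.countP_append, countP_le_eq_zero hw₁, List.countP_append] at ih
      omega

theorem time_le_of_triple_descent {l A C : List ℕ} {t x y z : ℕ}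
    (h : pop^[t] l = A ++ x :: y :: z :: C) (hyx : y < x) (hzy : z < y) : t ≤ 2 * A.length :=
  ((time_le_of_descent_pattern y l t A x y z C h hyx le_rfl hzy.le).2 hzy).trans
    (Nat.mul_le_mul_left 2 List.countP_le_length)

/-! ### Speed of small entries -/

/-- Some entry of `l` at (0-based) position at least `r` has value at most `κ`. -/
def HasSmallFrom (κ r : ℕ) (l : List ℕ) : Prop :=
  ∃ B a C, l = B ++ a :: C ∧ r ≤ B.length ∧ a ≤ κ

theorem HasSmallFrom.mono {κ r r' : ℕ} {l : List ℕ} (h : HasSmallFrom κ r l) (hr : r' ≤ r) :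
    HasSmallFrom κ r' l := by
  obtain ⟨B, a, C, h1, h2, h3⟩ := h
  exact ⟨B, a, C, h1, hr.trans h2, h3⟩

/-- The decreasing run of an entry of `l`, split at that entry. -/
theorem exists_run_at {l B C : List ℕ} {a : ℕ} (h : l = B ++ a :: C) :
    ∃ B' bs cs C' P Q, B = B' ++ bs ∧ C = cs ++ C' ∧
      (bs ++ a :: cs).Pairwise (fun x y => y < x) ∧
      pop l = P ++ (cs.reverse ++ a :: bs.reverse) ++ Q ∧ P.length = B'.length := by
  obtain ⟨L, hl, hL, hd, -, -⟩ := exists_blocks l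
  have : ∃ as bs cs ds, L = as ++ (bs ++ a :: cs) :: ds ∧ B = as.flatten ++ bs ∧
      C = cs ++ ds.flatten := by
    rcases List.flatten_eq_append_iff.1 (hl.trans h) with
      ⟨as, bs, h1, h2, h3⟩ | ⟨as, bs, c, cs, ds, h1, h2, h3⟩
    · obtain ⟨as', cs, ds, h4, h5, h6⟩ := List.flatten_eq_cons_iff.1 h3.symm
      refine ⟨as ++ as', [], cs, ds, by simp [h1, h4], ?_, h6⟩
      have : as'.flatten = [] := List.flatten_eq_nil_iff.2 h5
      simp [h2, this]
    · simp only [List.cons_append, List.cons.injEq] at h3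
      obtain ⟨rfl, h3⟩ := h3
      exact ⟨as, bs, cs, ds, h1, h2, h3⟩
  obtain ⟨as, bs, cs, ds, rfl, hB, hC⟩ := this
  refine ⟨as.flatten, bs, cs, ds.flatten, (as.map List.reverse).flatten,
    (ds.map List.reverse).flatten, hB, hC, hd _ (by simp), ?_,
    (flatten_map_reverse_perm as).length_eq⟩
  rw [← hL]; simp

theorem HasSmallFrom.pop_iterate_succ {κ r t : ℕ} {l : List ℕ}
    (h : HasSmallFrom κ r (pop^[t + 1] l)) :
    HasSmallFrom κ (r - 2) (pop^[t + 2] l) ∧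
      (2 * r < t + 5 → HasSmallFrom κ (r - 1) (pop^[t + 2] l)) := by
  obtain ⟨B, a, C, hu, hr, ha⟩ := h
  obtain ⟨B', bs, cs, C', P, Q, rfl, rfl, hd, hp, hlen⟩ := exists_run_at hu
  have hlt : bs.length < 3 := by
    by_contra! hge
    rcases List.eq_nil_or_concat bs with rfl | ⟨bs, z, rfl⟩
    · simp at hge
    rcases List.eq_nil_or_concat bs with rfl | ⟨bs, y, rfl⟩
    · simp at hge
    rcases List.eq_nil_or_concat bs with rfl | ⟨bs, x, rfl⟩
    · simp at hge
    simp only [List.concat_eq_append, List.append_assoc, List.cons_append, List.nil_append] at *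
    have hd' := (List.pairwise_append.1 hd).2.1
    simp only [List.pairwise_cons, List.mem_cons, forall_eq_or_imp] at hd'
    rw [Function.iterate_succ_apply'] at hu
    exact pop_ne_of_four_descending _ (B' ++ bs) (cs ++ C') hd'.1.1 hd'.2.1.1 hd'.2.2.1.1
      (by simpa using hu)
  have hfirst : HasSmallFrom κ B'.length (pop^[t + 2] l) := by
    rw [Function.iterate_succ_apply', hp]
    rcases List.eq_nil_or_concat cs with rfl | ⟨cs, c, rfl⟩
    -- The tracked entry may change: the first entry of the reversed run is at most `a`.
    · exact ⟨P, a, bs.reverse ++ Q, by simp, hlen.ge, ha⟩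
    · refine ⟨P, c, cs.reverse ++ a :: bs.reverse ++ Q, by simp, hlen.ge, ?_⟩
      have := (List.pairwise_cons.1 (List.pairwise_append.1 hd).2.1).1 c (by simp)
      omega
  rw [List.length_append] at hr
  refine ⟨hfirst.mono (by omega), fun htr => hfirst.mono ?_⟩
  match bs, hlt with
  | [], _ => simp at hr; omega
  | [_], _ => simp at hr; omega
  | [x, y], _ =>
    simp only [List.cons_append, List.nil_append, List.pairwise_cons, List.mem_cons,
      forall_eq_or_imp] at hd
    -- A move by 2 forces `t + 1 ≤ 2 * B'.length`, so the new position is still at least `r - 1`.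
    have := time_le_of_triple_descent (l := l) (t := t + 1) (A := B') (C := cs ++ C')
      (by simpa using hu) hd.1.1 hd.2.1.1
    simp at hr
    omega

theorem HasSmallFrom.fast {κ r : ℕ} {l : List ℕ} (h : HasSmallFrom κ r (pop l)) (t : ℕ) :
    HasSmallFrom κ (r - 2 * t) (pop^[t + 1] l) := by
  induction t with
  | zero => exact h
  | succ t ih => exact ih.pop_iterate_succ.1.mono (by omega)

theorem HasSmallFrom.slow {κ r t₀ : ℕ} {l : List ℕ} (h : HasSmallFrom κ r (pop^[t₀ + 1] l))
    (ht : 2 * r < t₀ + 5) (t : ℕ) : HasSmallFrom κ (r - t) (pop^[t₀ + t + 1] l) := by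
  induction t with
  | zero => exact h
  | succ t ih => exact (ih.pop_iterate_succ.2 (by omega)).mono (by omega)

theorem HasSmallFrom.lt_of_range' {κ r n : ℕ} (h : HasSmallFrom κ r (List.range' 1 n)) :
    r < κ := by
  obtain ⟨B, a, C, hu, hr, ha⟩ := h
  have h1 : (List.range' 1 n)[B.length]? = some a := by rw [hu]; simp
  rw [List.getElem?_eq_some_iff] at h1
  obtain ⟨_, h1⟩ := h1
  simp at h1
  omega

/-- A small entry far to the right after the first step forces a long running time. -/
theorem HasSmallFrom.three_mul_le {κ r n t : ℕ} {l : List ℕ} (h : HasSmallFrom κ r (pop l))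
    (ht : pop^[t + 1] l = List.range' 1 n) : 3 * r ≤ 5 * t + 15 * κ + 5 := by
  -- The slow regime begins once `2 * (r - 2t)` falls to about `t`, that is, at `t ≈ 2r/5`.
  rcases le_or_gt t (2 * r / 5) with hle | hlt
  · have := (ht ▸ h.fast t).lt_of_range'
    omega
  · obtain ⟨s, rfl⟩ := Nat.exists_eq_add_of_lt hlt
    have h2 := (h.fast (2 * r / 5 + 1)).slow (by omega) s
    rw [show 2 * r / 5 + 1 + s + 1 = 2 * r / 5 + s + 1 + 1 by ring, ht] at h2
    have := h2.lt_of_range'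
    omega

/-! ### Two rare events -/

/-- A uniformly random permutation is decreasing on `W` with probability at most `1 / #W`. -/
theorem card_mul_card_strictAntiOn_le {α : Type*} [Fintype α] [LinearOrder α] (W : Finset α)
    [DecidablePred fun σ : Equiv.Perm α => StrictAntiOn σ W] :
    W.card * (Finset.univ.filter fun σ : Equiv.Perm α => StrictAntiOn σ W).card ≤
      Fintype.card (Equiv.Perm α) := by
  rcases W.eq_empty_or_nonempty with rfl | hW
  · simp
  set ℓ := W.max' hW
  have hℓ : ℓ ∈ W := W.max'_mem hW
  rw [← Finset.card_product, ← Finset.card_univ]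
  -- After the swap the minimum over `W` is attained at `w`, which recovers `w`.
  refine Finset.card_le_card_of_injOn (fun p => p.2 * Equiv.swap p.1 ℓ) (by simp) ?_
  have key : ∀ w ∈ W, ∀ σ : Equiv.Perm α, StrictAntiOn σ W → ∀ u ∈ W, u ≠ w →
      (σ * Equiv.swap w ℓ) w < (σ * Equiv.swap w ℓ) u := by
    intro w hw σ hσ u hu huw
    simp only [Equiv.Perm.mul_apply, Equiv.swap_apply_left]
    have hmem : Equiv.swap w ℓ u ∈ W := by
      rw [Equiv.swap_apply_def]; split_ifs <;> assumption
    refine hσ hmem hℓ (lt_of_le_of_ne (W.le_max' _ hmem) fun h => huw ?_)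
    exact (Equiv.swap w ℓ).injective (by rw [h, Equiv.swap_apply_left])
  rintro ⟨w, σ⟩ h ⟨w', σ'⟩ h' heq
  simp only [Finset.coe_product, Set.mem_prod, Finset.mem_coe, Finset.mem_filter,
    Finset.mem_univ, true_and] at h h' heq
  have hw : w = w' := by
    by_contra hne
    have h1 := key w h.1 σ h.2 w' h'.1 (Ne.symm hne)
    have h2 := key w' h'.1 σ' h'.2 w h.1 hne
    rw [heq] at h1
    exact lt_asymm h1 h2
  subst hw
  simpa using heq

/-- A uniformly random permutation maps no element of `W` into `V` with probability at most
`n / (#V * #W)`. -/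
theorem card_mul_card_avoiding_le {α : Type*} [Fintype α] [DecidableEq α] (V W : Finset α)
    [DecidablePred fun σ : Equiv.Perm α => ∀ j ∈ W, σ j ∉ V] :
    V.card * W.card *
        (Finset.univ.filter fun σ : Equiv.Perm α => ∀ j ∈ W, σ j ∉ V).card ≤
      Fintype.card (Equiv.Perm α) * Fintype.card α := by
  rw [← Finset.card_product, ← Finset.card_product, ← Fintype.card_prod, ← Finset.card_univ]
  -- After the swap `j` is the only element of `W` sent into `V`, so `j` and then `v` are recovered;
  -- the second component undoes the swap.
  refine Finset.card_le_card_of_injOn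
    (fun p => (p.2 * Equiv.swap p.1.2 (p.2.symm p.1.1), p.2.symm p.1.1)) (by simp) ?_
  have key : ∀ v ∈ V, ∀ j ∈ W, ∀ σ : Equiv.Perm α, (∀ j ∈ W, σ j ∉ V) → ∀ i ∈ W, i ≠ j →
      (σ * Equiv.swap j (σ.symm v)) i ∉ V := by
    intro v hv j hj σ hσ i hi hij
    rw [Equiv.Perm.mul_apply, Equiv.swap_apply_of_ne_of_ne hij]
    · exact hσ i hi
    · rintro rfl
      exact hσ _ hi (by simpa using hv)
  rintro ⟨⟨v, j⟩, σ⟩ h ⟨⟨v', j'⟩, σ'⟩ h' heq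
  simp only [Finset.coe_product, Set.mem_prod, Finset.mem_coe, Finset.mem_filter,
    Finset.mem_univ, true_and, Prod.mk.injEq] at h h' heq
  obtain ⟨h1, h2⟩ := heq
  have hval : ∀ (τ : Equiv.Perm α) (w : α) (i : α), (τ * Equiv.swap i (τ.symm w)) i = w := by
    intro τ w i; simp
  have hj : j = j' := by
    by_contra hne
    refine key v' h'.1.1 j' h'.1.2 σ' h'.2 j h.1.2 hne ?_
    rw [← h1, hval]
    exact h.1.1
  subst hj
  have hv : v = v' := by rw [← hval σ v j, h1, hval]
  subst hv
  rw [h2] at h1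
  simpa using h1

/-! ### From typical permutations to the average -/

theorem hasSmallFrom_pop_oneLine {n m : ℕ} (σ : Equiv.Perm (Fin n)) (j : Fin n)
    (hj : n ≤ j + m) (hσ : (σ j : ℕ) < m)
    (hdec : ¬ StrictAntiOn σ {i : Fin n | n ≤ i + 2 * m ∧ (i : ℕ) + m < n}) :
    HasSmallFrom m (n - 2 * m) (pop (oneLine σ)) := by
  have hlen : (oneLine σ).length = n := by simp [oneLine]
  have hget : ∀ i (hi : i < n), (oneLine σ)[i]? = some ((σ ⟨i, hi⟩ : ℕ) + 1) := by
    intro i hi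
    rw [List.getElem?_eq_some_iff]
    exact ⟨by omega, by simp [oneLine]⟩
  have hj' : (j : ℕ) < (oneLine σ).length := by rw [hlen]; exact j.2
  have hsplit : oneLine σ =
      (oneLine σ).take j ++ (oneLine σ)[(j : ℕ)] :: (oneLine σ).drop (j + 1) := by simp
  have ha : (oneLine σ)[(j : ℕ)] ≤ m := by simp [oneLine]; omega
  obtain ⟨B', bs, cs, C', P, Q, hB, hC, hd, hp, hPlen⟩ := exists_run_at hsplit
  have hBlen : B'.length + bs.length = j := by
    rw [← List.length_append, ← hB]; simp; omega
  -- A run starting earlier and reaching `j` would be decreasing on the whole window.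
  have hpos : n - 2 * m ≤ B'.length := by
    by_contra! hlt
    refine hdec fun i hi i' hi' hii => ?_
    simp only [Set.mem_ofPred_eq] at hi hi'
    have hii' : (i : ℕ) < i' := hii
    have hentry : ∀ k : Fin n, n ≤ k + 2 * m → (k : ℕ) + m < n →
        ∃ h : (k : ℕ) - B'.length < bs.length, bs[(k : ℕ) - B'.length] = (σ k : ℕ) + 1 := by
      intro k hk1 hk2
      have h1 := hget k k.2
      rw [hsplit, hB, List.append_assoc, List.getElem?_append_right (by omega),
        List.getElem?_append_left (by omega)] at h1
      exact List.getElem?_eq_some_iff.1 h1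
    obtain ⟨h1, e1⟩ := hentry i hi.1 hi.2
    obtain ⟨h2, e2⟩ := hentry i' hi'.1 hi'.2
    have := List.pairwise_iff_getElem.1 (List.pairwise_append.1 hd).1 _ _ h1 h2 (by omega)
    rw [e1, e2] at this
    exact Fin.lt_def.2 (by omega)
  rcases List.eq_nil_or_concat cs with rfl | ⟨cs, c, rfl⟩
  · exact ⟨P, _, bs.reverse ++ Q, by rw [hp]; simp, by omega, ha⟩
  · refine ⟨P, c, cs.reverse ++ (oneLine σ)[(j : ℕ)] :: bs.reverse ++ Q,
      by rw [hp]; simp, by omega, ?_⟩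
    have := (List.pairwise_cons.1 (List.pairwise_append.1 hd).2.1).1 c (by simp)
    omega

theorem popTime_lower_bound {n m : ℕ} (σ : Equiv.Perm (Fin n)) (j : Fin n)
    (hj : n ≤ j + m) (hσ : (σ j : ℕ) < m)
    (hdec : ¬ StrictAntiOn σ {i : Fin n | n ≤ i + 2 * m ∧ (i : ℕ) + m < n}) :
    3 * n ≤ 5 * popTime σ + 21 * m := by
  have hspec : pop^[popTime σ] (oneLine σ) = List.range' 1 n :=
    Nat.find_spec (exists_pop_iterate_eq_range σ)
  have hs := hasSmallFrom_pop_oneLine σ j hj hσ hdec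
  rcases hT : popTime σ with _ | t
  · rw [hT] at hspec
    have h1 : (σ j : ℕ) + 1 = 1 + j := by
      have h2 : (oneLine σ)[(j : ℕ)]? = some ((σ j : ℕ) + 1) := by
        rw [List.getElem?_eq_some_iff]
        exact ⟨by simp [oneLine], by simp [oneLine]⟩
      rw [show oneLine σ = List.range' 1 n from hspec, List.getElem?_eq_some_iff] at h2
      obtain ⟨_, h2⟩ := h2
      simpa using h2.symm
    omega
  · rw [hT] at hspec
    have := hs.three_mul_le hspec
    omega

theorem card_filter_fin_eq_sub {n a b : ℕ} (hb : b ≤ n) (p : Fin n → Prop) [DecidablePred p]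
    (hp : ∀ i : Fin n, p i ↔ a ≤ i ∧ (i : ℕ) < b) : (Finset.univ.filter p).card = b - a := by
  rw [← Nat.card_Ico, ← Finset.card_map Fin.valEmbedding]
  congr 1
  ext k
  simp only [Finset.mem_map, Finset.mem_filter, Finset.mem_univ, true_and, hp,
    Fin.valEmbedding_apply, Finset.mem_Ico]
  exact ⟨by rintro ⟨i, hi, rfl⟩; exact hi, fun hk => ⟨⟨k, by omega⟩, hk, rfl⟩⟩

theorem sum_popTime_lower_bound {n m : ℕ} (hmn : 7 * m ≤ n) :
    ((m : ℝ) ^ 2 - m - n) * Fintype.card (Equiv.Perm (Fin n)) * (3 * n - 21 * m) ≤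
      5 * m ^ 2 * ∑ σ : Equiv.Perm (Fin n), (popTime σ : ℝ) := by
  classical
  set W : Finset (Fin n) := Finset.univ.filter fun i => n ≤ i + 2 * m ∧ (i : ℕ) + m < n with hW
  set V : Finset (Fin n) := Finset.univ.filter fun i => (i : ℕ) < m with hV
  set U : Finset (Fin n) := Finset.univ.filter fun i => n ≤ i + m with hU
  have hWc : W.card = m := by
    rw [hW, card_filter_fin_eq_sub (a := n - 2 * m) (b := n - m) (by omega) _ (by omega)]; omega
  have hVc : V.card = m := by
    rw [hV, card_filter_fin_eq_sub (a := 0) (b := m) (by omega) _ (by omega)]; omega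
  have hUc : U.card = m := by
    rw [hU, card_filter_fin_eq_sub (a := n - m) (b := n) le_rfl _ (by omega)]; omega
  set F₁ := Finset.univ.filter fun σ : Equiv.Perm (Fin n) => StrictAntiOn σ W
  set F₂ := Finset.univ.filter fun σ : Equiv.Perm (Fin n) => ∀ j ∈ U, σ j ∉ V
  have h₁ : (m : ℝ) * F₁.card ≤ Fintype.card (Equiv.Perm (Fin n)) := by
    have := card_mul_card_strictAntiOn_le W
    rw [hWc] at this
    exact_mod_cast this
  have h₂ : (m : ℝ) * m * F₂.card ≤ Fintype.card (Equiv.Perm (Fin n)) * n := by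
    have := card_mul_card_avoiding_le V U
    rw [hVc, hUc, Fintype.card_fin] at this
    exact_mod_cast this
  have hpos : (0 : ℝ) ≤ 3 * n - 21 * m := by
    have : (7 * m : ℝ) ≤ n := by exact_mod_cast hmn
    linarith
  have hgood : ∀ σ ∈ (F₁ ∪ F₂)ᶜ, (3 * n - 21 * m : ℝ) ≤ 5 * popTime σ := by
    intro σ hσ
    rw [Finset.mem_compl, Finset.mem_union, not_or] at hσ
    obtain ⟨hσ₁, hσ₂⟩ := hσ
    simp only [F₁, F₂, Finset.mem_filter, Finset.mem_univ, true_and, not_forall, not_not] at hσ₁ hσ₂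
    obtain ⟨j, hjU, hjV⟩ := hσ₂
    have := popTime_lower_bound σ j (by simpa [hU] using hjU) (by simpa [hV] using hjV)
      (by simpa [hW] using hσ₁)
    have : (3 * n : ℝ) ≤ 5 * popTime σ + 21 * m := by exact_mod_cast this
    linarith
  have hcard : (Fintype.card (Equiv.Perm (Fin n)) : ℝ) ≤
      ((F₁ ∪ F₂)ᶜ.card : ℝ) + F₁.card + F₂.card := by
    have h3 := Finset.card_add_card_compl (F₁ ∪ F₂)
    have h4 := Finset.card_union_le F₁ F₂
    exact_mod_cast (by omega : Fintype.card (Equiv.Perm (Fin n)) ≤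
      (F₁ ∪ F₂)ᶜ.card + F₁.card + F₂.card)
  have hsum : ((F₁ ∪ F₂)ᶜ.card : ℝ) * (3 * n - 21 * m) ≤
      5 * ∑ σ : Equiv.Perm (Fin n), (popTime σ : ℝ) := by
    rw [Finset.mul_sum, ← nsmul_eq_mul]
    exact (Finset.card_nsmul_le_sum _ _ _ hgood).trans
      (Finset.sum_le_univ_sum_of_nonneg fun σ => by positivity)
  -- Union bound with failure probabilities `1/m` and `n/m²`, cleared of denominators.
  have hcount : ((m : ℝ) ^ 2 - m - n) * Fintype.card (Equiv.Perm (Fin n)) ≤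
      m ^ 2 * ((F₁ ∪ F₂)ᶜ.card : ℝ) := by
    have h5 := mul_le_mul_of_nonneg_left hcard (sq_nonneg (m : ℝ))
    have h6 := mul_le_mul_of_nonneg_left h₁ (Nat.cast_nonneg (α := ℝ) m)
    nlinarith
  calc _ ≤ (m : ℝ) ^ 2 * ((F₁ ∪ F₂)ᶜ.card : ℝ) * (3 * n - 21 * m) :=
        mul_le_mul_of_nonneg_right hcount hpos
    _ ≤ m ^ 2 * (5 * ∑ σ : Equiv.Perm (Fin n), (popTime σ : ℝ)) := by
        rw [mul_assoc]; exact mul_le_mul_of_nonneg_left hsum (sq_nonneg _)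
    _ = _ := by ring

theorem avgPopTime_lower_bound {n m : ℕ} (hm : 0 < m) (hmn : 7 * m ≤ n) :
    (1 - 1 / (m : ℝ) - n / (m : ℝ) ^ 2) * (3 * n - 21 * m) / 5 ≤ avgPopTime n := by
  have hN : (0 : ℝ) < Fintype.card (Equiv.Perm (Fin n)) := by exact_mod_cast Fintype.card_pos
  have hm' : (0 : ℝ) < m := by exact_mod_cast hm
  rw [avgPopTime, le_div_iff₀ hN]
  have h := sum_popTime_lower_bound hmn
  have h5 : (0 : ℝ) < 5 * m ^ 2 := by positivity
  rw [← div_le_iff₀' h5] at h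
  refine le_of_eq_of_le ?_ h
  field_simp

theorem avgPopTime_div_lower_bound {n K : ℕ} (hK : 7 ≤ K) (hn : 2 * K ≤ n) :
    (1 - (2 * K + 4 * K ^ 2) / (n : ℝ)) * (3 / 5 - 21 / (5 * K)) ≤ avgPopTime n / n := by
  have hK0 : (0 : ℝ) < K := by exact_mod_cast (by omega : 0 < K)
  have hn0 : (0 : ℝ) < n := by exact_mod_cast (by omega : 0 < n)
  have hK7 : (7 : ℝ) ≤ K := by exact_mod_cast hK
  have hnonneg : (0 : ℝ) ≤ 3 / 5 - 21 / (5 * K) := by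
    rw [sub_nonneg, div_le_div_iff₀ (by positivity) (by norm_num)]; linarith
  rcases lt_or_ge (1 - (2 * K + 4 * K ^ 2) / (n : ℝ)) 0 with hneg | hge
  · refine (mul_nonpos_of_nonpos_of_nonneg hneg.le hnonneg).trans ?_
    exact div_nonneg (div_nonneg (Finset.sum_nonneg fun _ _ => Nat.cast_nonneg _)
      (Nat.cast_nonneg _)) hn0.le
  set m := n / K with hmdef
  have hmK : m * K ≤ n := Nat.div_mul_le_self n K
  have hm2 : n < m * K + K := by
    have := Nat.lt_div_mul_add (a := n) (show 0 < K by omega)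
    simpa [hmdef] using this
  have hm0 : 0 < m := Nat.div_pos (by omega) (by omega)
  have hm : (0 : ℝ) < m := by exact_mod_cast hm0
  have hmK' : (m : ℝ) * K ≤ n := by exact_mod_cast hmK
  have hlow : (n : ℝ) ≤ 2 * K * m := by
    exact_mod_cast (by nlinarith : n ≤ 2 * K * m)
  have h1 : 1 / (m : ℝ) ≤ 2 * K / n := by
    rw [div_le_div_iff₀ hm hn0]; linarith
  have h2 : (n : ℝ) / m ^ 2 ≤ 4 * K ^ 2 / n := by
    rw [div_le_div_iff₀ (by positivity) hn0]
    nlinarith [mul_le_mul hlow hlow hn0.le (by positivity)]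
  have hmain := avgPopTime_lower_bound hm0 (by nlinarith : 7 * m ≤ n)
  rw [le_div_iff₀ hn0]
  refine le_trans ?_ hmain
  have h3 : (3 / 5 - 21 / (5 * K)) * (n : ℝ) ≤ (3 * n - 21 * m) / 5 := by
    have : (m : ℝ) ≤ n / K := by rwa [le_div_iff₀ hK0]
    have e : (3 / 5 - 21 / (5 * K)) * (n : ℝ) = (3 * n - 21 * (n / K)) / 5 := by field_simp
    rw [e]; linarith
  rw [mul_assoc, mul_div_assoc]
  refine mul_le_mul ?_ h3 (mul_nonneg hnonneg hn0.le) ?_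
  · rw [add_div]; linarith
  · rw [add_div] at hge; linarith

/-- The lower limit is taken in the extended reals, where it exists for every sequence. -/
theorem theorem1p1 :
    (((3 / 5 : ℝ)) : EReal) ≤
      Filter.liminf (fun n : ℕ => ((avgPopTime n / (n : ℝ) : ℝ) : EReal)) Filter.atTop := by
  rw [← EReal.ge_of_forall_gt_iff_ge]
  intro c hc
  have hc' : c < 3 / 5 := EReal.coe_lt_coe_iff.1 hc
  have hK : Filter.Tendsto (fun K : ℕ => (3 / 5 - 21 / 5 / (K : ℝ) : ℝ)) Filter.atTop
      (nhds (3 / 5 - 0)) :=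
    tendsto_const_nhds.sub (tendsto_const_div_atTop_nhds_zero_nat _)
  rw [sub_zero] at hK
  obtain ⟨K, hcK, hK7⟩ := ((hK.eventually (lt_mem_nhds hc')).and
    (Filter.eventually_ge_atTop 7)).exists
  have hn : Filter.Tendsto (fun n : ℕ =>
      (1 - (2 * K + 4 * K ^ 2) / (n : ℝ)) * (3 / 5 - 21 / 5 / (K : ℝ))) Filter.atTop
      (nhds ((1 - 0) * (3 / 5 - 21 / 5 / (K : ℝ)))) :=
    (tendsto_const_nhds.sub (tendsto_const_div_atTop_nhds_zero_nat _)).mul_const _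
  rw [sub_zero, one_mul] at hn
  refine Filter.le_liminf_of_le (by isBoundedDefault) ?_
  filter_upwards [hn.eventually (lt_mem_nhds hcK), Filter.eventually_ge_atTop (2 * K)]
    with n hcn hn2
  have := avgPopTime_div_lower_bound hK7 hn2
  rw [← div_div] at this
  exact EReal.coe_le_coe_iff.2 (hcn.le.trans this)
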